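/- **Setting.** Let $\|\cdot\|$ be an arbitrary norm on $\mathbb{R}^q$ with dual norm $\|\cdot\|_*$. Let $C\subsetneq\mathbb{R}^q$ be a closed convex solid pointed cone, $X\subseteq\mathbb{R}^n$ convex, $\Gamma:X\to\mathbb{R}^q$ continuous and $C$-convex, i.e. $\lambda\Gamma(x_1)+(1-\lambda)\Gamma(x_2)-\Gamma(\lambda x_1+(1-\lambda)x_2)\in C$ for all $x_1,x_2\in X$, $\lambda\in[0,1]$, and let $\mathcal{X}\subseteq X$ be compact and convex with nonempty interior. Put $\mathcal{P}=\Gamma(\mathcal{X})+C$ and $C^+=\{w: w^{\mathsf T}y\ge 0\ \forall y\in C\}$. Denote by $\delta^H$ the Hausdorff distance and by $\operatorname{ext}A$ the set of extreme points of $A$. **Initialization.** Choose $w^1,\dots,w^J$ with $\|w^j\|_*=1$ that generate the convex cone $C^+$, and $x^j\in\operatorname{argmin}_{x\in\mathcal{X}}(w^j)^{\mathsf T}\Gamma(x)$ for each $j$. Put $\mathcal{P}_0^{\rm out}=\bigcap_j\{y:(w^j)^{\mathsf T}y\ge (w^j)^{\mathsf T}\Gamma(x^j)\}$ and $\bar w=\sum_j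 w^j/\|\sum_j w^j\|_*$. Choose $\beta\ge\sup_{x\in\mathcal{X}}\bar w^{\mathsf T}\Gamma(x)$ and $$\gamma>\sup_{x\in\mathcal{X}}\bar w^{\mathsf T}\Gamma(x)+\max_{v\in\operatorname{ext}\mathcal{P}_0^{\rm out}}(\bar w^{\mathsf T}v-\beta)^++\delta^H(\mathcal{P}_0^{\rm out},\mathcal{P}).$$ Put $\bar{\mathcal{P}}_0^{\rm out}=\mathcal{P}_0^{\rm out}\cap\{y:\bar w^{\mathsf T}y\le\gamma\}$, $\bar{\mathcal{X}}_0=\{x^1,\dots,x^J\}$, $\mathcal{V}^{\rm known}=\mathcal{V}^{\rm known2}=\emptyset$ and $k=0$. **Scalarization.** For $v\in\mathbb{R}^q$, the problem $(\mathrm{P}(v))$ is to minimize $\|z\|$ subject to $v+z-\Gamma(x)\in C$, $\bar w^{\mathsf T}(v+z)\le\gamma$, $x\in\mathcal{X}$, $z\in\mathbb{R}^q$. Its Lagrange dual $(\mathrm{D}(v))$ is to maximize $$\inf_{x\in\mathcal{X},\,z\in\mathbb{R}^q}\big(\|z\|+w^{\mathsf T}(\Gamma(x)-z-v)+\lambda(\bar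 w^{\mathsf T}(v+z)-\gamma)\big)$$ over $w\in C^+$, $\lambda\ge0$. **Main loop** (tolerance $\varepsilon>0$). Iteration $k$ is as follows. 1. Compute $\operatorname{ext}\bar{\mathcal{P}}_k^{\rm out}$. For each of its points $v\notin\mathcal{V}^{\rm known}$, in any order: if $v\notin\mathcal{V}^{\rm known2}$, compute and store optimal solutions $(x^v,z^v)$ of $(\mathrm{P}(v))$ and $(w^v,\lambda^v)$ of $(\mathrm{D}(v))$. Then, if $\|z^v\|\le\varepsilon$, add $x^v$ to $\bar{\mathcal{X}}_k$ and $v$ to $\mathcal{V}^{\rm known}$; otherwise add $v$ to $\mathcal{V}^{\rm known2}$. 2. Choose $v^k\in\operatorname{argmax}\{\|z^v\|: v\in\operatorname{ext}\bar{\mathcal{P}}_k^{\rm out}\}$. If $\|z^{v^k}\|\le\varepsilon$, stop. Otherwise, with $\tilde w=w^{v^k}-\lambda^{v^k}\bar w$, put $$\bar{\mathcal{P}}_{k+1}^{\rm out}=\bar{\mathcal{P}}_k^{\rm out}\cap\{y:\tilde w^{\mathsf T}y\ge\tilde w^{\mathsf T}(v^k+z^{v^k})\},\qquad \bar{\mathcal{X}}_{k+1}=\bar{\mathcal{X}}_k,$$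 and continue with iteration $k+1$. **Theorem.** If the cone $C$ is polyhedral, then the initialization can be carried out, and for every choice made in it and every $\varepsilon>0$ the algorithm terminates after finitely many iterations. That is, whatever vertex orders, optimal solutions and maximizers are chosen, every step of the main loop can be carried out (there are finitely many extreme points, and the required optimal solutions and maximizers exist), and there is no infinite execution. -/

import Mathlib

open Set
open scoped Pointwise

noncomputable section

namespace CVOPAlg

/-! Throughout, a finite-dimensional real normed space `E` plays the role of `ℝ^q` with an
arbitrary fixed norm. A vector `w` acting by `y ↦ wᵀy` is a continuous linear functional
`w : StrongDual ℝ E`, whose operator norm is the dual norm `‖w‖_*`. -/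

/-- The dual cone `C⁺ = {w | wᵀy ≥ 0 for all y ∈ C}`. -/
def dualCone {E : Type*} [NormedAddCommGroup E] [NormedSpace ℝ E] (C : Set E) :
    Set (StrongDual ℝ E) :=
  {w | ∀ y ∈ C, 0 ≤ w y}

/-- The convex cone generated by finitely many functionals `w 0, …, w (J - 1)`. -/
def generatedCone {E : Type*} [NormedAddCommGroup E] [NormedSpace ℝ E] {J : ℕ}
    (w : Fin J → StrongDual ℝ E) : Set (StrongDual ℝ E) :=
  {u | ∃ t : Fin J → ℝ, (∀ j, 0 ≤ t j) ∧ u = ∑ j, t j • w j}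

/-- A polyhedral cone: a finite intersection of closed halfspaces through the origin. -/
def IsPolyhedralCone {E : Type*} [NormedAddCommGroup E] [NormedSpace ℝ E] (C : Set E) : Prop :=
  ∃ (m : ℕ) (a : Fin m → StrongDual ℝ E), C = {y | ∀ i, 0 ≤ a i y}

/-- A convex vector optimization problem: minimize `Γ x` with respect to `≤_C` over `x ∈ feas`. -/
structure CVOP (n : ℕ) (E : Type*) [NormedAddCommGroup E] [NormedSpace ℝ E] where
  /-- the ordering cone -/
  C : ConvexCone ℝ E
  C_closed : IsClosed (C : Set E)
  C_solid : (interior (C : Set E)).Nonempty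
  C_pointed : (C : Set E) ∩ -(C : Set E) = {0}
  C_ne_univ : (C : Set E) ≠ univ
  /-- the domain of the objective; the values of `Γ` outside `X` play no role -/
  X : Set (EuclideanSpace ℝ (Fin n))
  X_convex : Convex ℝ X
  /-- the objective function -/
  Γ : EuclideanSpace ℝ (Fin n) → E
  Γ_continuous : ContinuousOn Γ X
  Γ_convex : ∀ x₁ ∈ X, ∀ x₂ ∈ X, ∀ t : ℝ, 0 ≤ t → t ≤ 1 →
    (t • Γ x₁ + (1 - t) • Γ x₂) - Γ (t • x₁ + (1 - t) • x₂) ∈ C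
  /-- the feasible region -/
  feas : Set (EuclideanSpace ℝ (Fin n))
  feas_subset : feas ⊆ X
  feas_compact : IsCompact feas
  feas_convex : Convex ℝ feas
  feas_interior : (interior feas).Nonempty

variable {n : ℕ} {E : Type*} [NormedAddCommGroup E] [NormedSpace ℝ E]

/-- The upper image `Γ(𝒳) + C`. -/
def CVOP.upperImage (P : CVOP n E) : Set E := P.Γ '' P.feas + (P.C : Set E)

/-- `x` is an optimal solution of the weighted sum problem: minimize `wᵀΓ(x)` over `x ∈ 𝒳`. -/
def CVOP.IsWeightedSumOptimal (P : CVOP n E) (w : StrongDual ℝ E)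
    (x : EuclideanSpace ℝ (Fin n)) : Prop :=
  x ∈ P.feas ∧ ∀ x' ∈ P.feas, w (P.Γ x) ≤ w (P.Γ x')

/-- `(x, z)` is feasible for the modified norm-minimizing scalarization at `v`:
`Γ(x) - z - v ≤_C 0`, `w̄ᵀ(v + z) ≤ γ`, `x ∈ 𝒳`. -/
def CVOP.PrimalFeasible (P : CVOP n E) (wbar : StrongDual ℝ E) (γ : ℝ) (v : E)
    (x : EuclideanSpace ℝ (Fin n)) (z : E) : Prop :=
  x ∈ P.feas ∧ -(P.Γ x - z - v) ∈ P.C ∧ wbar (v + z) ≤ γ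

/-- `(x, z)` is optimal for the modified scalarization at `v`: it minimizes `‖z‖`. -/
def CVOP.IsPrimalOptimal (P : CVOP n E) (wbar : StrongDual ℝ E) (γ : ℝ) (v : E)
    (x : EuclideanSpace ℝ (Fin n)) (z : E) : Prop :=
  P.PrimalFeasible wbar γ v x z ∧
    ∀ x' z', P.PrimalFeasible wbar γ v x' z' → ‖z‖ ≤ ‖z'‖

/-- The extended-real Lagrange dual objective
`φ(w, l) = inf_{x ∈ 𝒳, z} (‖z‖ + wᵀ(Γ(x) - z - v) + l (w̄ᵀ(v + z) - γ))`. -/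
def CVOP.dualObjective (P : CVOP n E) (wbar : StrongDual ℝ E) (γ : ℝ) (v : E)
    (w : StrongDual ℝ E) (l : ℝ) : EReal :=
  ⨅ x ∈ P.feas, ⨅ z : E,
    ((‖z‖ + w (P.Γ x - z - v) + l * (wbar (v + z) - γ) : ℝ) : EReal)

/-- `(w, l)` is optimal for the Lagrange dual at `v`: it maximizes `φ` over `C⁺ × [0, ∞)`. -/
def CVOP.IsDualOptimal (P : CVOP n E) (wbar : StrongDual ℝ E) (γ : ℝ) (v : E)
    (w : StrongDual ℝ E) (l : ℝ) : Prop :=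
  (w ∈ dualCone (P.C : Set E) ∧ 0 ≤ l) ∧
    ∀ w' ∈ dualCone (P.C : Set E), ∀ l' : ℝ, 0 ≤ l' →
      P.dualObjective wbar γ v w' l' ≤ P.dualObjective wbar γ v w l

/-- `w̄ = (∑ⱼ wʲ) / ‖∑ⱼ wʲ‖_*`. -/
def normalizedSum {J : ℕ} (w : Fin J → StrongDual ℝ E) : StrongDual ℝ E :=
  ‖∑ j, w j‖⁻¹ • ∑ j, w j

/-- `P₀ᵒᵘᵗ = ⋂ⱼ {y | (wʲ)ᵀy ≥ (wʲ)ᵀΓ(xʲ)}`. -/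
def CVOP.initialOuter (P : CVOP n E) {J : ℕ} (w : Fin J → StrongDual ℝ E)
    (xs : Fin J → EuclideanSpace ℝ (Fin n)) : Set E :=
  ⋂ j, {y | w j (P.Γ (xs j)) ≤ w j y}

/-- The data chosen in the initialization phase of the algorithm: normalized generators `wʲ`
of `C⁺`, optimal solutions `xʲ` of the weighted sum problems, and the constants `β`, `γ`. -/
structure Setup (P : CVOP n E) where
  J : ℕ
  w : Fin J → StrongDual ℝ E
  w_norm : ∀ j, ‖w j‖ = 1
  w_generates : dualCone (P.C : Set E) = generatedCone w
  xs : Fin J → EuclideanSpace ℝ (Fin n)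
  xs_optimal : ∀ j, P.IsWeightedSumOptimal (w j) (xs j)
  β : ℝ
  β_ge : sSup ((fun x => normalizedSum w (P.Γ x)) '' P.feas) ≤ β
  γ : ℝ
  γ_gt : sSup ((fun x => normalizedSum w (P.Γ x)) '' P.feas)
      + sSup ((fun v => max (normalizedSum w v - β) 0) ''
          (P.initialOuter w xs).extremePoints ℝ)
      + Metric.hausdorffDist (P.initialOuter w xs) P.upperImage < γ

/-- The vector `w̄` of a setup. -/
def Setup.wbar {P : CVOP n E} (S : Setup P) : StrongDual ℝ E := normalizedSum S.w

/-- The compact initial outer approximation `P₀ᵒᵘᵗ ∩ {y | w̄ᵀy ≤ γ}`. -/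
def Setup.outer0 {P : CVOP n E} (S : Setup P) : Set E :=
  P.initialOuter S.w S.xs ∩ {y | S.wbar y ≤ S.γ}

/-- A record `(xᵛ, zᵛ)`, `(wᵛ, lᵛ)` of solutions of the scalarization and of its dual. -/
structure Sol (n : ℕ) (E : Type*) [NormedAddCommGroup E] [NormedSpace ℝ E] where
  x : EuclideanSpace ℝ (Fin n)
  z : E
  w : StrongDual ℝ E
  l : ℝ

/-- The record `s` consists of optimal solutions of the scalarization at `v` and of its dual. -/
def Setup.IsSol {P : CVOP n E} (S : Setup P) (v : E) (s : Sol n E) : Prop :=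
  P.IsPrimalOptimal S.wbar S.γ v s.x s.z ∧ P.IsDualOptimal S.wbar S.γ v s.w s.l

/-- The program variables. -/
structure State (n : ℕ) (E : Type*) [NormedAddCommGroup E] [NormedSpace ℝ E] where
  /-- the iteration counter -/
  k : ℕ
  /-- the current outer approximation -/
  outer : Set E
  /-- the current set of weak minimizers -/
  Xbar : Set (EuclideanSpace ℝ (Fin n))
  /-- vertices already found to satisfy `‖zᵛ‖ ≤ ε` -/
  known : Set E
  /-- vertices already found to satisfy `‖zᵛ‖ > ε` -/
  known2 : Set E
  /-- the stored solutions; the entry at `v` is meaningful once `v` has been treated -/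
  sol : E → Sol n E

/-- The state before the first iteration (the initial content of the solution memory is
arbitrary). -/
def Setup.IsInitialState {P : CVOP n E} (S : Setup P) (σ : State n E) : Prop :=
  σ.k = 0 ∧ σ.outer = S.outer0 ∧ σ.Xbar = range S.xs ∧ σ.known = ∅ ∧ σ.known2 = ∅

/-- Inside the loop over vertices: if `v ∉ known2`, then arbitrary optimal solutions of the
scalarization at `v` and of its dual are computed and stored; otherwise nothing happens. -/
def Setup.Solve {P : CVOP n E} (S : Setup P) (v : E) (σ τ : State n E) : Prop :=
  (v ∈ σ.known2 ∧ τ = σ) ∨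
    (v ∉ σ.known2 ∧ ∃ s, S.IsSol v s ∧
      τ = { σ with sol := fun u => open Classical in if u = v then s else σ.sol u })

/-- Inside the loop over vertices: the test `‖zᵛ‖ ≤ ε` and the resulting updates. -/
def State.classify (ε : ℝ) (v : E) (σ : State n E) : State n E :=
  open Classical in
  if ‖(σ.sol v).z‖ ≤ ε then
    { σ with Xbar := σ.Xbar ∪ {(σ.sol v).x}, known := σ.known ∪ {v} }
  else
    { σ with known2 := σ.known2 ∪ {v} }

/-- `v ∈ argmax {‖zᵘ‖ | u a vertex of the current outer approximation}`. -/
def State.IsFarthest (σ : State n E) (v : E) : Prop :=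
  v ∈ σ.outer.extremePoints ℝ ∧
    ∀ u ∈ σ.outer.extremePoints ℝ, ‖(σ.sol u).z‖ ≤ ‖(σ.sol v).z‖

/-- The update with the halfspace `{y | w̃ᵀy ≥ w̃ᵀ(v + zᵛ)}`, where `w̃ = wᵛ - lᵛ w̄`. -/
def Setup.cut {P : CVOP n E} (S : Setup P) (v : E) (σ : State n E) : State n E :=
  { σ with
    k := σ.k + 1
    outer := σ.outer ∩
      {y | ((σ.sol v).w - (σ.sol v).l • S.wbar) (v + (σ.sol v).z) ≤
            ((σ.sol v).w - (σ.sol v).l • S.wbar) y} }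

/-- Configurations of the algorithm: program variables together with the control location. -/
inductive Config (n : ℕ) (E : Type*) [NormedAddCommGroup E] [NormedSpace ℝ E]
  /-- about to start an iteration of the main (repeat) loop -/
  | start (σ : State n E)
  /-- inside the loop over vertices, with the list of vertices still to be treated -/
  | vertices (todo : List E) (σ : State n E)
  /-- terminated -/
  | done (σ : State n E)

/-- One elementary step of the algorithm with tolerance `ε`. All choices that the algorithm
leaves open (the order of the vertices, the optimal solutions, the farthest vertex) are
arbitrary. -/
inductive Step {P : CVOP n E} (S : Setup P) (ε : ℝ) : Config n E → Config n E → Prop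
  /-- compute the vertices of the outer approximation and list, in any order, those that are
  not in `known` -/
  | enumerate (σ : State n E) (todo : List E) (hnodup : todo.Nodup)
      (hmem : ∀ v, v ∈ todo ↔ v ∈ σ.outer.extremePoints ℝ \ σ.known) :
      Step S ε (.start σ) (.vertices todo σ)
  /-- treat the next vertex -/
  | treat (v : E) (todo : List E) (σ τ : State n E) (hsolve : S.Solve v σ τ) :
      Step S ε (.vertices (v :: todo) σ) (.vertices todo (τ.classify ε v))
  /-- a farthest vertex has `‖zᵛ‖ > ε`: cut and go to the next iteration -/
  | refine (v : E) (σ : State n E) (hv : σ.IsFarthest v) (hε : ε < ‖(σ.sol v).z‖) :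
      Step S ε (.vertices [] σ) (.start (S.cut v σ))
  /-- a farthest vertex has `‖zᵛ‖ ≤ ε`: stop -/
  | stop_ (v : E) (σ : State n E) (hv : σ.IsFarthest v) (hε : ‖(σ.sol v).z‖ ≤ ε) :
      Step S ε (.vertices [] σ) (.done σ)

/-- Every execution of the algorithm terminates after finitely many steps: there is no infinite
execution, and no execution gets stuck before it has terminated. -/
def Setup.Terminates {P : CVOP n E} (S : Setup P) (ε : ℝ) : Prop :=
  (¬ ∃ c : ℕ → Config n E,
      (∃ σ, S.IsInitialState σ ∧ c 0 = .start σ) ∧ ∀ i, Step S ε (c i) (c (i + 1))) ∧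
  (∀ σ c, S.IsInitialState σ → Relation.ReflTransGen (Step S ε) (.start σ) c →
      (∃ τ, c = .done τ) ∨ ∃ c', Step S ε c c')

end CVOPAlg

end

open Filter Topology

namespace CVOPAlg

variable {n : ℕ} {E : Type*} [NormedAddCommGroup E] [NormedSpace ℝ E]

/-! ### Functionals and cones -/

/-! The problem (P(v)) projects v onto the truncated upper image, the part of `P.upperImage` where
w̄ᵀy ≤ γ. Since γ exceeds every value of w̄ᵀΓ on the feasible set, Slater's condition holds.
Separating convex sets then gives multipliers (`exists_multipliers`), so there is no duality gap and
every dual optimum is a multiplier (`le_lagrangian`). Consequently w̃ = w - λw̄ has dual norm at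
most 1 and satisfies w̃ᵀz = ‖z‖. The cut therefore keeps the truncated upper image (`cut_le`) but
removes the open ball of radius ‖z‖ about v (`norm_le_dist`).

All outer approximations lie in one compact set (`isCompact_outer0`), which finitely many balls of
radius ε/2 cover. A cut is made only if ‖z‖ > ε, so it empties the covering ball that holds v
(`ballCount_lt`), and only finitely many cuts occur.

Nothing gets stuck: polyhedra have finitely many extreme points, nonempty compact sets have at least
one, and all scalarizations are solvable. Polyhedrality of C supplies the finite generators of C⁺ by
Farkas' lemma, and with pointedness it makes the initial truncation bounded. -/

lemma generatedCone_subset_dualCone {J : ℕ} {C : Set E} {w : Fin J → StrongDual ℝ E}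
    (hw : ∀ j, w j ∈ dualCone C) : generatedCone w ⊆ dualCone C := by
  rintro _ ⟨t, ht, rfl⟩ y hy
  simp only [sum_apply, smul_apply, smul_eq_mul]
  exact Finset.sum_nonneg fun j _ => mul_nonneg (ht j) (hw j y hy)

lemma mem_generatedCone {J : ℕ} (w : Fin J → StrongDual ℝ E) (j : Fin J) :
    w j ∈ generatedCone w := by
  classical
  exact ⟨Pi.single j 1, fun i => by by_cases h : i = j <;> simp [h],
    by simp [Pi.single_apply]⟩

lemma smul_mem_generatedCone {J : ℕ} {w : Fin J → StrongDual ℝ E} {u : StrongDual ℝ E}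
    (hu : u ∈ generatedCone w) {r : ℝ} (hr : 0 ≤ r) : r • u ∈ generatedCone w := by
  obtain ⟨t, ht, rfl⟩ := hu
  exact ⟨fun j => r * t j, fun j => mul_nonneg hr (ht j), by simp [Finset.smul_sum, smul_smul]⟩

lemma convex_generatedCone {J : ℕ} (w : Fin J → StrongDual ℝ E) :
    Convex ℝ (generatedCone w) := by
  rintro _ ⟨s, hs, rfl⟩ _ ⟨t, ht, rfl⟩ a b ha hb -
  refine ⟨fun j => a * s j + b * t j,
    fun j => add_nonneg (mul_nonneg ha (hs j)) (mul_nonneg hb (ht j)), ?_⟩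
  simp [Finset.smul_sum, smul_smul, add_smul, Finset.sum_add_distrib]

/-- A nonzero functional in the dual cone is positive on the interior of the cone. -/
lemma dualCone_pos_of_mem_interior {C : Set E} {w : StrongDual ℝ E} (hw : w ∈ dualCone C)
    (hw0 : w ≠ 0) {c : E} (hc : c ∈ interior C) : 0 < w c := by
  -- A nonzero functional is an open map, so this image is an open subset of [0, ∞) and misses 0.
  have hopen : IsOpen (w '' interior C) := w.isOpenMap_of_ne_zero hw0 _ isOpen_interior
  have hsub : w '' interior C ⊆ Ici 0 := by
    rintro _ ⟨y, hy, rfl⟩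
    exact hw y (interior_subset hy)
  have := interior_maximal hsub hopen ⟨c, hc, rfl⟩
  simpa using this

/-- In finite dimension, every functional on the dual space is an evaluation. -/
lemma exists_eval_eq [FiniteDimensional ℝ E] (f : StrongDual ℝ (StrongDual ℝ E)) :
    ∃ y : E, ∀ w : StrongDual ℝ E, f w = w y := by
  let g : Module.Dual ℝ (Module.Dual ℝ E) :=
    f.toLinearMap ∘ₗ (LinearMap.toContinuousLinearMap : (E →ₗ[ℝ] ℝ) ≃ₗ[ℝ] _).toLinearMap
  refine ⟨(Module.evalEquiv ℝ E).symm g, fun w => ?_⟩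
  have h : w ((Module.evalEquiv ℝ E).symm g) = g w.toLinearMap :=
    Module.apply_evalEquiv_symm_apply ℝ E (w.toLinearMap : Module.Dual ℝ E) g
  rw [h]
  change f w = f (LinearMap.toContinuousLinearMap w.toLinearMap)
  congr 1

/-- Farkas' lemma for a solid polyhedral cone. -/
lemma dualCone_eq_generatedCone [FiniteDimensional ℝ E] {J : ℕ} {C : Set E}
    {w : Fin J → StrongDual ℝ E} (hw0 : ∀ j, w j ≠ 0) (hC : C = {y | ∀ j, 0 ≤ w j y})
    (hint : (interior C).Nonempty) : dualCone C = generatedCone w := by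
  have hwC : ∀ j, w j ∈ dualCone C := fun j y hy => by rw [hC] at hy; exact hy j
  refine Subset.antisymm (fun u hu => ?_) (generatedCone_subset_dualCone hwC)
  obtain ⟨c, hc⟩ := hint
  rcases eq_or_ne u 0 with rfl | hu0
  · exact ⟨0, by simp, by simp⟩
  have huc := dualCone_pos_of_mem_interior hu hu0 hc
  have hwc := fun j => dualCone_pos_of_mem_interior (hwC j) (hw0 j) hc
  -- Scaling to value 1 at c replaces the cone by a base, the hull of finitely many points, whose
  -- closedness is immediate.
  let K := convexHull ℝ (range fun j => (w j c)⁻¹ • w j)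
  have hKcone : K ⊆ generatedCone w := by
    refine convexHull_min ?_ (convex_generatedCone w)
    rintro _ ⟨j, rfl⟩
    exact smul_mem_generatedCone (mem_generatedCone w j) (inv_nonneg.2 (hwc j).le)
  by_cases huK : (u c)⁻¹ • u ∈ K
  · have := smul_mem_generatedCone (hKcone huK) huc.le
    rwa [smul_smul, mul_inv_cancel₀ huc.ne', one_smul] at this
  exfalso
  obtain ⟨f, s, hfs, hf⟩ := geometric_hahn_banach_point_closed (convex_convexHull ℝ _)
    ((finite_range fun j => (w j c)⁻¹ • w j).isClosed_convexHull ℝ) huK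
  obtain ⟨y, hy⟩ := exists_eval_eq f
  -- On the base, s separates: u y < s * u c, while w j y > s * w j c for all j. Shifting y by s • c
  -- turns this into signs.
  have hmem : y - s • c ∈ C := by
    rw [hC]
    intro j
    have h := hf _ (subset_convexHull ℝ _ ⟨j, rfl⟩)
    rw [hy] at h
    simp only [smul_apply, smul_eq_mul] at h
    rw [lt_inv_mul_iff₀ (hwc j)] at h
    simp only [map_sub, map_smul, smul_eq_mul]
    linarith
  have h1 := hu _ hmem
  rw [hy] at hfs
  simp only [smul_apply, smul_eq_mul] at hfs
  rw [inv_mul_lt_iff₀ huc] at hfs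
  simp only [map_sub, map_smul, smul_eq_mul] at h1
  linarith

/-! ### Polyhedra -/

/-- A set is polyhedral if it is the intersection of finitely many closed halfspaces. -/
def IsPolyhedralSet (O : Set E) : Prop :=
  ∃ F : Set (StrongDual ℝ E × ℝ), F.Finite ∧ O = {y | ∀ p ∈ F, p.2 ≤ p.1 y}

lemma IsPolyhedralSet.inter_halfspace {O : Set E} (hO : IsPolyhedralSet O)
    (a : StrongDual ℝ E) (b : ℝ) : IsPolyhedralSet (O ∩ {y | b ≤ a y}) := by
  obtain ⟨F, hF, rfl⟩ := hO
  refine ⟨insert (a, b) F, hF.insert _, ?_⟩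
  ext y
  simp [and_comm]

lemma IsPolyhedralSet.isClosed {O : Set E} (hO : IsPolyhedralSet O) : IsClosed O := by
  obtain ⟨F, -, rfl⟩ := hO
  simp only [ofPred_forall]
  exact isClosed_biInter fun p _ => isClosed_le continuous_const p.1.continuous

/-- A polyhedral set has only finitely many extreme points. -/
lemma IsPolyhedralSet.finite_extremePoints {O : Set E} (hO : IsPolyhedralSet O) :
    (O.extremePoints ℝ).Finite := by
  obtain ⟨F, hF, rfl⟩ := hO
  -- An extreme point is determined by its set of active constraints.
  refine Set.Finite.of_injOn (f := fun v => {p ∈ F | p.1 v = p.2}) (t := 𝒫 F)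
    (fun v _ => sep_subset _ _) ?_ hF.finite_subsets
  intro u hu v hv huv
  have hact : ∀ p ∈ F, p.1 u = p.2 → p.1 v = p.2 := fun p hp h =>
    ((Set.ext_iff.1 huv p).1 ⟨hp, h⟩).2
  -- A direction annihilated by the constraints active at u can be followed a little way without
  -- leaving the polyhedron.
  have hev : ∀ d : E, (∀ p ∈ F, p.1 u = p.2 → p.1 d = 0) →
      ∀ᶠ t : ℝ in 𝓝 0, ∀ p ∈ F, p.2 ≤ p.1 (u + t • d) := by
    intro d hd
    refine (eventually_all_finite hF).2 fun p hp => ?_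
    rcases (hu.1 p hp).eq_or_lt with h | h
    · exact Eventually.of_forall fun t => by simp [hd p hp h.symm, h]
    · have hcont : Continuous fun t : ℝ => p.1 (u + t • d) := by fun_prop
      have h0 : p.2 < p.1 (u + (0 : ℝ) • d) := by simpa using h
      exact (hcont.continuousAt.eventually (lt_mem_nhds h0)).mono fun t ht => ht.le
  have h1 := hev (v - u) fun p hp h => by simp [hact p hp h, h]
  have h2 := hev (-(v - u)) fun p hp h => by simp [hact p hp h, h]
  have h3 : ∀ᶠ t : ℝ in 𝓝[>] 0, 0 < t := self_mem_nhdsWithin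
  obtain ⟨t, ⟨ht1, ht2⟩, ht⟩ :=
    (((h1.and h2).filter_mono (nhdsWithin_le_nhds (s := Ioi 0))).and h3).exists
  have hmid : u ∈ openSegment ℝ (u + t • (v - u)) (u + t • -(v - u)) :=
    ⟨1 / 2, 1 / 2, by norm_num, by norm_num, by norm_num, by module⟩
  have := (mem_extremePoints.1 hu).2 _ ht1 _ ht2 hmid
  have h4 : t • (v - u) = 0 := by simpa using this.1
  rcases smul_eq_zero.1 h4 with h | h
  · exact absurd h ht.ne'
  · exact (sub_eq_zero.1 h).symm

/-- If finitely many functionals have trivial common kernel, then a set on which each of them is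
bounded is bounded. -/
lemma isBounded_of_functionals [FiniteDimensional ℝ E] {J : ℕ} (w : Fin J → StrongDual ℝ E)
    (hw : ∀ y, (∀ j, w j y = 0) → y = 0) {O : Set E} (M : ℝ)
    (hM : ∀ y ∈ O, ∀ j, |w j y| ≤ M) : Bornology.IsBounded O := by
  let f : E →ₗ[ℝ] (Fin J → ℝ) := LinearMap.pi fun j => (w j).toLinearMap
  have hf : LinearMap.ker f = ⊥ := by
    rw [LinearMap.ker_eq_bot']
    exact fun y hy => hw y fun j => congrFun hy j
  obtain ⟨K, -, hK⟩ := f.exists_antilipschitzWith hf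
  refine (hK.isBounded_preimage (s := Metric.closedBall 0 (max M 0))
    Metric.isBounded_closedBall).subset fun y hy => ?_
  rw [mem_preimage, mem_closedBall_zero_iff, pi_norm_le_iff_of_nonneg (le_max_right _ _)]
  exact fun j => (hM y hy j).trans (le_max_left _ _)

/-! ### The initialization -/

variable (P : CVOP n E)

lemma CVOP.feas_nonempty : P.feas.Nonempty := P.feas_interior.mono interior_subset

lemma CVOP.isCompact_image : IsCompact (P.Γ '' P.feas) :=
  P.feas_compact.image_of_continuousOn (P.Γ_continuous.mono P.feas_subset)

lemma CVOP.isClosed_upperImage : IsClosed P.upperImage := by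
  have := P.C_closed.vadd_left_of_isCompact P.isCompact_image
  simpa [CVOP.upperImage] using this

lemma CVOP.le_sSup_image (w : StrongDual ℝ E) {x : EuclideanSpace ℝ (Fin n)}
    (hx : x ∈ P.feas) : w (P.Γ x) ≤ sSup ((fun x => w (P.Γ x)) '' P.feas) := by
  refine le_csSup ?_ ⟨x, hx, rfl⟩
  have : IsCompact (w '' (P.Γ '' P.feas)) := P.isCompact_image.image w.continuous
  rw [image_image] at this
  exact this.bddAbove

lemma CVOP.exists_isWeightedSumOptimal (w : StrongDual ℝ E) :
    ∃ x, P.IsWeightedSumOptimal w x := by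
  have hcont : ContinuousOn (fun x => w (P.Γ x)) P.feas :=
    w.continuous.comp_continuousOn (P.Γ_continuous.mono P.feas_subset)
  obtain ⟨x, hx, hmin⟩ := P.feas_compact.exists_isMinOn P.feas_nonempty hcont
  exact ⟨x, hx, fun x' hx' => hmin hx'⟩

lemma CVOP.exists_generators [FiniteDimensional ℝ E] (hC : IsPolyhedralCone (P.C : Set E)) :
    ∃ (J : ℕ) (w : Fin J → StrongDual ℝ E), (∀ j, ‖w j‖ = 1) ∧
      dualCone (P.C : Set E) = generatedCone w := by
  classical
  obtain ⟨m, a, ha⟩ := hC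
  let I := {i : Fin m // a i ≠ 0}
  let e : Fin (Fintype.card I) ≃ I := (Fintype.equivFin I).symm
  have hpos : ∀ i : I, 0 < ‖a i‖ := fun i => norm_pos_iff.2 i.2
  refine ⟨Fintype.card I, fun j => ‖a (e j)‖⁻¹ • a (e j), fun j => ?_, ?_⟩
  · rw [norm_smul, norm_inv, norm_norm, inv_mul_cancel₀ (hpos _).ne']
  · refine dualCone_eq_generatedCone
      (fun j => smul_ne_zero (inv_ne_zero (hpos _).ne') (e j).2) ?_ P.C_solid
    rw [ha]
    ext y
    refine ⟨fun h j => mul_nonneg (inv_nonneg.2 (norm_nonneg _)) (h _), fun h i => ?_⟩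
    by_cases hi : a i = 0
    · simp [hi]
    · have h1 := h (e.symm ⟨i, hi⟩)
      simp only [Equiv.apply_symm_apply, smul_apply, smul_eq_mul] at h1
      exact (mul_nonneg_iff_of_pos_left (inv_pos.2 (hpos ⟨i, hi⟩))).1 h1

lemma CVOP.nonempty_setup [FiniteDimensional ℝ E] (hC : IsPolyhedralCone (P.C : Set E)) :
    Nonempty (Setup P) := by
  obtain ⟨J, w, hw1, hw⟩ := P.exists_generators hC
  choose xs hxs using fun j => P.exists_isWeightedSumOptimal (w j)
  exact ⟨⟨J, w, hw1, hw, xs, hxs, _, le_rfl, _, lt_add_one _⟩⟩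

/-! ### Truncation of the upper image and compactness of the initial outer approximation -/

variable {P} (S : Setup P)

lemma Setup.gen_mem_dualCone (j : Fin S.J) : S.w j ∈ dualCone (P.C : Set E) :=
  S.w_generates ▸ mem_generatedCone S.w j

/-- The other two summands below γ are nonnegative, also when `sSup` or `hausdorffDist` takes its
default value 0. This is the source of Slater's condition. -/
lemma Setup.wbar_lt {x : EuclideanSpace ℝ (Fin n)} (hx : x ∈ P.feas) :
    S.wbar (P.Γ x) < S.γ := by
  have h1 := P.le_sSup_image (normalizedSum S.w) hx
  have h2 : 0 ≤ sSup ((fun v => max (normalizedSum S.w v - S.β) 0) ''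
      (P.initialOuter S.w S.xs).extremePoints ℝ) :=
    Real.sSup_nonneg (by rintro _ ⟨v, -, rfl⟩; exact le_max_right _ _)
  have h3 := Metric.hausdorffDist_nonneg (s := P.initialOuter S.w S.xs) (t := P.upperImage)
  have := S.γ_gt
  simp only [Setup.wbar]
  linarith

/-- The part `P ∩ {y | w̄ᵀy ≤ γ}` of the upper image. -/
def Setup.truncatedImage : Set E := P.upperImage ∩ {y | S.wbar y ≤ S.γ}

lemma Setup.truncatedImage_nonempty : S.truncatedImage.Nonempty := by
  obtain ⟨x, hx⟩ := P.feas_nonempty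
  have h0 : (0 : E) ∈ (P.C : Set E) := by
    have : (0 : E) ∈ (P.C : Set E) ∩ -(P.C : Set E) := by rw [P.C_pointed]; rfl
    exact this.1
  exact ⟨P.Γ x, ⟨_, ⟨x, hx, rfl⟩, 0, h0, add_zero _⟩, (S.wbar_lt hx).le⟩

lemma Setup.isClosed_truncatedImage : IsClosed S.truncatedImage :=
  P.isClosed_upperImage.inter (isClosed_le S.wbar.continuous continuous_const)

lemma Setup.truncatedImage_subset_outer0 : S.truncatedImage ⊆ S.outer0 := by
  rintro _ ⟨⟨_, ⟨x, hx, rfl⟩, c, hc, rfl⟩, hy⟩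
  refine ⟨mem_iInter.2 fun j => ?_, hy⟩
  have h1 := (S.xs_optimal j).2 x hx
  have h2 := S.gen_mem_dualCone j c hc
  simp only [mem_ofPred_eq, map_add]
  linarith

lemma Setup.isPolyhedralSet_outer0 : IsPolyhedralSet S.outer0 := by
  have h : IsPolyhedralSet (P.initialOuter S.w S.xs) :=
    ⟨range fun j => (S.w j, S.w j (P.Γ (S.xs j))), finite_range _, by
      ext y; simp [CVOP.initialOuter]⟩
  convert h.inter_halfspace (-S.wbar) (-S.γ) using 1
  ext y
  simp [Setup.outer0]

/-- Each generator is bounded below by its own constraint and their sum is bounded above by the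
truncation, so each is bounded. Their common kernel lies in C ∩ -C. -/
lemma Setup.isCompact_outer0 [FiniteDimensional ℝ E] (hC : IsPolyhedralCone (P.C : Set E)) :
    IsCompact S.outer0 := by
  have := FiniteDimensional.proper_real E
  refine Metric.isCompact_of_isClosed_isBounded S.isPolyhedralSet_outer0.isClosed ?_
  let b : Fin S.J → ℝ := fun j => S.w j (P.Γ (S.xs j))
  let G : ℝ := ‖∑ j, S.w j‖ * S.γ
  refine isBounded_of_functionals S.w ?_ (|G| + 2 * ∑ j, |b j|) ?_
  · intro y hy
    obtain ⟨m, a, ha⟩ := hC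
    have hay : ∀ i, a i y = 0 := fun i => by
      have hmem : a i ∈ dualCone (P.C : Set E) := fun z hz => by rw [ha] at hz; exact hz i
      rw [S.w_generates] at hmem
      obtain ⟨t, -, h⟩ := hmem
      simp [h, sum_apply, hy]
    have : y ∈ (P.C : Set E) ∩ -(P.C : Set E) := by
      rw [ha]
      exact ⟨fun i => (hay i).ge, fun i => by simp [hay i]⟩
    rw [P.C_pointed] at this
    exact this
  · rintro y ⟨hy, hyγ⟩ j
    have hb : ∀ i, b i ≤ S.w i y := fun i => mem_iInter.1 hy i
    have hsum : ∑ i, S.w i y ≤ G := by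
      -- If the generators sum to zero, then w̄ is 0 by default and both sides vanish.
      have h1 : ‖∑ j, S.w j‖ * S.wbar y = ∑ i, S.w i y := by
        rcases eq_or_ne (∑ j, S.w j) 0 with h | h
        · have := DFunLike.congr_fun h y
          simp only [sum_apply, zero_apply] at this
          simp [h, this]
        · simp only [Setup.wbar, normalizedSum, smul_apply, sum_apply, smul_eq_mul]
          rw [mul_inv_cancel_left₀ (norm_ne_zero_iff.2 h)]
      rw [← h1]
      exact mul_le_mul_of_nonneg_left hyγ (norm_nonneg _)
    have h2 : S.w j y - b j ≤ ∑ i, (S.w i y - b i) :=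
      Finset.single_le_sum (f := fun i => S.w i y - b i) (fun i _ => sub_nonneg.2 (hb i))
        (Finset.mem_univ j)
    have h3 : |b j| ≤ ∑ i, |b i| :=
      Finset.single_le_sum (f := fun i => |b i|) (fun i _ => abs_nonneg _) (Finset.mem_univ j)
    have h4 : |∑ i, b i| ≤ ∑ i, |b i| := Finset.abs_sum_le_sum_abs _ _
    rw [Finset.sum_sub_distrib] at h2
    have h5 := le_abs_self G
    have h6 := abs_nonneg G
    have h7 := abs_le.1 h4
    have h8 := abs_le.1 (le_refl |b j|)
    have h9 := hb j
    rw [abs_le]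
    constructor <;> linarith

/-! ### Strong duality for the scalarization -/

lemma CVOP.add_mem_interior {c d : E} (hc : c ∈ interior (P.C : Set E)) (hd : d ∈ P.C) :
    c + d ∈ interior (P.C : Set E) := by
  have hsub : (· + d) '' interior (P.C : Set E) ⊆ P.C := by
    rintro _ ⟨y, hy, rfl⟩
    exact P.C.add_mem (interior_subset hy) hd
  exact interior_maximal hsub (isOpenMap_add_right d _ isOpen_interior) ⟨c, hc, rfl⟩

lemma CVOP.smul_mem_interior {c : E} (hc : c ∈ interior (P.C : Set E)) {t : ℝ} (ht : 0 < t) :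
    t • c ∈ interior (P.C : Set E) := by
  have hsub : (t • ·) '' interior (P.C : Set E) ⊆ P.C := by
    rintro _ ⟨y, hy, rfl⟩
    exact P.C.smul_mem ht (interior_subset hy)
  exact interior_maximal hsub (isOpenMap_smul₀ ht.ne' _ isOpen_interior) ⟨c, hc, rfl⟩

/-- Triples `(u, s, r)` such that the scalarization at `v` with right-hand sides perturbed by `u`
and `s` has a strictly feasible point with objective value less than `r`. -/
def CVOP.perturbations (P : CVOP n E) (wbar : StrongDual ℝ E) (γ : ℝ) (v : E) :
    Set (E × ℝ × ℝ) :=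
  {p | ∃ x ∈ P.feas, ∃ z : E, p.1 - (P.Γ x - z - v) ∈ interior (P.C : Set E) ∧
    wbar (v + z) - γ < p.2.1 ∧ ‖z‖ < p.2.2}

lemma CVOP.isOpen_perturbations (wbar : StrongDual ℝ E) (γ : ℝ) (v : E) :
    IsOpen (P.perturbations wbar γ v) := by
  have h : P.perturbations wbar γ v = ⋃ x ∈ P.feas, ⋃ z : E,
      {p | p.1 - (P.Γ x - z - v) ∈ interior (P.C : Set E)} ∩
        ({p | wbar (v + z) - γ < p.2.1} ∩ {p | ‖z‖ < p.2.2}) := by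
    ext p
    simp [CVOP.perturbations]
  rw [h]
  refine isOpen_biUnion fun x _ => isOpen_iUnion fun z => ?_
  exact (isOpen_interior.preimage (by fun_prop)).inter
    ((isOpen_lt continuous_const (by fun_prop)).inter (isOpen_lt continuous_const (by fun_prop)))

/-- The convexity defect of Γ lies in C and is absorbed by the interior of C. -/
lemma CVOP.convex_perturbations (wbar : StrongDual ℝ E) (γ : ℝ) (v : E) :
    Convex ℝ (P.perturbations wbar γ v) := by
  refine convex_iff_forall_pos.2 ?_
  rintro ⟨u₁, s₁, r₁⟩ ⟨x₁, hx₁, z₁, hu₁, hs₁, hr₁⟩ ⟨u₂, s₂, r₂⟩ ⟨x₂, hx₂, z₂, hu₂, hs₂, hr₂⟩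
    a b ha hb hab
  simp only at hu₁ hs₁ hr₁ hu₂ hs₂ hr₂
  obtain rfl : b = 1 - a := by linarith
  refine ⟨a • x₁ + (1 - a) • x₂, P.feas_convex hx₁ hx₂ ha.le hb.le hab,
    a • z₁ + (1 - a) • z₂, ?_, ?_, ?_⟩
  · have hint := P.C.convex.interior hu₁ hu₂ ha.le hb.le hab
    have hΓ := P.Γ_convex x₁ (P.feas_subset hx₁) x₂ (P.feas_subset hx₂) a ha.le (by linarith)
    convert P.add_mem_interior hint hΓ using 1
    simp only [Prod.smul_mk, Prod.mk_add_mk]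
    module
  · simp only [Prod.smul_mk, Prod.mk_add_mk, map_add, map_smul, smul_eq_mul] at *
    nlinarith
  · simp only [Prod.smul_mk, Prod.mk_add_mk, smul_eq_mul]
    calc ‖a • z₁ + (1 - a) • z₂‖ ≤ a * ‖z₁‖ + (1 - a) * ‖z₂‖ := by
          refine (norm_add_le _ _).trans_eq ?_
          rw [norm_smul, norm_smul, Real.norm_of_nonneg ha.le, Real.norm_of_nonneg hb.le]
      _ < a * r₁ + (1 - a) * r₂ := by
          have h1 := mul_lt_mul_of_pos_left hr₁ ha
          have h2 := mul_lt_mul_of_pos_left hr₂ hb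
          linarith

/-- Lagrange multipliers for the scalarization. -/
lemma Setup.exists_multipliers (v : E) {x : EuclideanSpace ℝ (Fin n)} {z : E}
    (hxz : P.IsPrimalOptimal S.wbar S.γ v x z) :
    ∃ w ∈ dualCone (P.C : Set E), ∃ l : ℝ, 0 ≤ l ∧ ∀ x' ∈ P.feas, ∀ z' : E,
      ‖z‖ ≤ ‖z'‖ + w (P.Γ x' - z' - v) + l * (S.wbar (v + z') - S.γ) := by
  obtain ⟨c, hc⟩ := P.C_solid
  have hnot : ((0, 0, ‖z‖) : E × ℝ × ℝ) ∉ P.perturbations S.wbar S.γ v := by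
    rintro ⟨x', hx', z', hu, hs, hr⟩
    simp only [zero_sub] at hu hs hr
    have := hxz.2 x' z' ⟨hx', interior_subset hu, by linarith⟩
    linarith
  obtain ⟨f, hf⟩ := geometric_hahn_banach_point_open (P.convex_perturbations S.wbar S.γ v)
    (P.isOpen_perturbations S.wbar S.γ v) hnot
  let w : StrongDual ℝ E := f.comp (ContinuousLinearMap.inl ℝ E (ℝ × ℝ))
  let l : ℝ := f (0, 1, 0)
  let μ : ℝ := f (0, 0, 1)
  have hfw : ∀ u s r, f (u, s, r) = w u + l * s + μ * r := by
    intro u s r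
    have : ((u, s, r) : E × ℝ × ℝ) = (u, 0) + s • (0, 1, 0) + r • (0, 0, 1) := by simp
    rw [this, map_add, map_add, map_smul, map_smul]
    simp [w, l, μ, mul_comm]
  -- The slack t makes all three inequalities strict and will tend to 0; d, s and r vary
  -- independently to reveal the signs of w, l and μ.
  have hmem : ∀ x' ∈ P.feas, ∀ z' : E, ∀ t > (0 : ℝ), ∀ d ∈ P.C, ∀ s ≥ (0 : ℝ), ∀ r ≥ (0 : ℝ),
      μ * ‖z‖ < w (P.Γ x' - z' - v) + w d + t * w c +
        l * (S.wbar (v + z') - S.γ + s + t) + μ * (‖z'‖ + r + t) := by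
    intro x' hx' z' t ht d hd s hs r hr
    have := hf (P.Γ x' - z' - v + d + t • c, S.wbar (v + z') - S.γ + s + t, ‖z'‖ + r + t)
      ⟨x', hx', z', ?_, ?_, ?_⟩
    · rw [hfw, hfw] at this
      simpa using this
    · convert P.add_mem_interior (P.smul_mem_interior hc ht) hd using 1
      simp only
      abel
    · simp only
      linarith
    · simp only
      linarith
  have h0 : (0 : E) ∈ P.C := by
    have : (0 : E) ∈ (P.C : Set E) ∩ -(P.C : Set E) := by rw [P.C_pointed]; rfl
    exact this.1
  have hlim : ∀ x' ∈ P.feas, ∀ z' : E, ∀ d ∈ P.C, ∀ s ≥ (0 : ℝ), ∀ r ≥ (0 : ℝ),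
      μ * ‖z‖ ≤ w (P.Γ x' - z' - v) + w d + l * (S.wbar (v + z') - S.γ + s) + μ * (‖z'‖ + r) := by
    intro x' hx' z' d hd s hs r hr
    have hcont : Continuous fun t : ℝ => w (P.Γ x' - z' - v) + w d + t * w c +
        l * (S.wbar (v + z') - S.γ + s + t) + μ * (‖z'‖ + r + t) := by fun_prop
    have ht : Tendsto (fun t : ℝ => w (P.Γ x' - z' - v) + w d + t * w c +
        l * (S.wbar (v + z') - S.γ + s + t) + μ * (‖z'‖ + r + t)) (𝓝[>] 0)
        (𝓝 (w (P.Γ x' - z' - v) + w d + l * (S.wbar (v + z') - S.γ + s) + μ * (‖z'‖ + r))) := by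
      have := hcont.tendsto 0
      simp only [zero_mul, add_zero] at this
      exact this.mono_left nhdsWithin_le_nhds
    refine ge_of_tendsto ht ?_
    filter_upwards [self_mem_nhdsWithin] with t ht
    exact (hmem x' hx' z' t ht d hd s hs r hr).le
  have nonneg_of_ray : ∀ a b q : ℝ, (∀ t : ℝ, 0 < t → a ≤ b + t * q) → 0 ≤ q := by
    intro a b q h
    by_contra! hq
    have h1 := h ((|b - a| + 1) / -q) (div_pos (by positivity) (by linarith))
    have h2 : (|b - a| + 1) / -q * q = -(|b - a| + 1) := by
      rw [div_mul_eq_mul_div, div_eq_iff (by linarith)]; ring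
    have := le_abs_self (b - a)
    linarith
  obtain ⟨x₀, hx₀⟩ := P.feas_nonempty
  have hw : ∀ d ∈ P.C, 0 ≤ w d := fun d hd => by
    refine nonneg_of_ray (μ * ‖z‖)
      (w (P.Γ x₀ - 0 - v) + l * (S.wbar (v + 0) - S.γ) + μ * ‖(0 : E)‖) _ fun t ht => ?_
    have := hlim x₀ hx₀ 0 (t • d) (P.C.smul_mem ht hd) 0 le_rfl 0 le_rfl
    rw [map_smul, smul_eq_mul] at this
    linarith
  have hl : 0 ≤ l := by
    refine nonneg_of_ray (μ * ‖z‖)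
      (w (P.Γ x₀ - 0 - v) + w 0 + l * (S.wbar (v + 0) - S.γ) + μ * ‖(0 : E)‖) _ fun t ht => ?_
    have := hlim x₀ hx₀ 0 0 h0 t ht.le 0 le_rfl
    linarith
  have hμ : 0 ≤ μ := by
    refine nonneg_of_ray (μ * ‖z‖)
      (w (P.Γ x₀ - 0 - v) + w 0 + l * (S.wbar (v + 0) - S.γ) + μ * ‖(0 : E)‖) _ fun t ht => ?_
    have := hlim x₀ hx₀ 0 0 h0 0 le_rfl t ht.le
    linarith
  -- Slater's condition: if μ = 0, the strictly feasible choice z' = Γ(x₀) - v + t c makes the right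
  -- side of `hmem` nonpositive.
  have hμ0 : 0 < μ := by
    refine hμ.lt_of_ne' fun hμ0 => ?_
    have hev : ∀ᶠ t : ℝ in 𝓝[>] 0, S.wbar (P.Γ x₀ + t • c) + t < S.γ := by
      have hcont : Continuous fun t : ℝ => S.wbar (P.Γ x₀ + t • c) + t := by fun_prop
      have h1 : S.wbar (P.Γ x₀ + (0 : ℝ) • c) + 0 < S.γ := by simpa using S.wbar_lt hx₀
      exact (hcont.continuousAt.eventually (gt_mem_nhds h1)).filter_mono nhdsWithin_le_nhds
    have hev2 : ∀ᶠ t : ℝ in 𝓝[>] 0, 0 < t := self_mem_nhdsWithin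
    obtain ⟨t, ht, ht0⟩ := (hev.and hev2).exists
    have h1 := hmem x₀ hx₀ (P.Γ x₀ - v + t • c) t ht0 0 h0 0 le_rfl 0 le_rfl
    have h2 : P.Γ x₀ - (P.Γ x₀ - v + t • c) - v = -(t • c) := by abel
    have h3 : v + (P.Γ x₀ - v + t • c) = P.Γ x₀ + t • c := by abel
    rw [h2, h3, hμ0, map_neg, map_smul, map_zero, smul_eq_mul] at h1
    have h4 : 0 ≤ l * (S.γ - (S.wbar (P.Γ x₀ + t • c) + t)) := mul_nonneg hl (by linarith)
    linarith
  refine ⟨μ⁻¹ • w, fun d hd => mul_nonneg (inv_nonneg.2 hμ) (hw d hd), μ⁻¹ * l,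
    mul_nonneg (inv_nonneg.2 hμ) hl, fun x' hx' z' => ?_⟩
  have h1 := hlim x' hx' z' 0 h0 0 le_rfl 0 le_rfl
  rw [map_zero, add_zero, add_zero, add_zero] at h1
  have h2 := mul_le_mul_of_nonneg_left h1 (inv_nonneg.2 hμ)
  rw [inv_mul_cancel_left₀ hμ0.ne'] at h2
  refine h2.trans_eq ?_
  rw [smul_apply, smul_eq_mul]
  field_simp
  ring

lemma CVOP.le_dualObjective_iff {wbar : StrongDual ℝ E} {γ : ℝ} {v : E}
    {w : StrongDual ℝ E} {l r : ℝ} :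
    (r : EReal) ≤ P.dualObjective wbar γ v w l ↔
      ∀ x ∈ P.feas, ∀ z : E, r ≤ ‖z‖ + w (P.Γ x - z - v) + l * (wbar (v + z) - γ) := by
  simp only [CVOP.dualObjective, le_iInf_iff, EReal.coe_le_coe_iff]

/-- Weak duality. -/
lemma CVOP.dualObjective_le {wbar : StrongDual ℝ E} {γ : ℝ} {v : E}
    {w : StrongDual ℝ E} {l : ℝ} (hw : w ∈ dualCone (P.C : Set E)) (hl : 0 ≤ l)
    {x : EuclideanSpace ℝ (Fin n)} {z : E} (hxz : P.PrimalFeasible wbar γ v x z) :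
    P.dualObjective wbar γ v w l ≤ (‖z‖ : ℝ) := by
  refine (iInf₂_le x hxz.1).trans ((iInf_le _ z).trans (EReal.coe_le_coe_iff.2 ?_))
  have h1 := hw _ hxz.2.1
  rw [map_neg] at h1
  have h2 := mul_nonneg hl (sub_nonneg.2 hxz.2.2)
  linarith

/-- Eliminating x turns the scalarization into a nearest-point problem. -/
lemma CVOP.exists_primalFeasible_iff {wbar : StrongDual ℝ E} {γ : ℝ} {v z : E} :
    (∃ x, P.PrimalFeasible wbar γ v x z) ↔ v + z ∈ P.upperImage ∩ {y | wbar y ≤ γ} := by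
  constructor
  · rintro ⟨x, hx, hc, hγ⟩
    exact ⟨⟨_, ⟨x, hx, rfl⟩, _, hc, by simp only; abel⟩, hγ⟩
  · rintro ⟨⟨_, ⟨x, hx, rfl⟩, c, hc, h⟩, hγ⟩
    refine ⟨x, hx, ?_, hγ⟩
    simp only at h
    have : -(P.Γ x - z - v) = c := by
      rw [← sub_eq_iff_eq_add'.2 h.symm]; abel
    rwa [this]

lemma Setup.exists_isPrimalOptimal [FiniteDimensional ℝ E] (v : E) :
    ∃ x z, P.IsPrimalOptimal S.wbar S.γ v x z := by
  have := FiniteDimensional.proper_real E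
  obtain ⟨y, hy, hmin⟩ :=
    S.isClosed_truncatedImage.exists_infDist_eq_dist S.truncatedImage_nonempty v
  obtain ⟨x, hx⟩ := (P.exists_primalFeasible_iff (v := v) (z := y - v)).2
    (by rwa [add_sub_cancel])
  refine ⟨x, y - v, hx, fun x' z' h' => ?_⟩
  have h1 := Metric.infDist_le_dist_of_mem (x := v) (P.exists_primalFeasible_iff.1 ⟨x', h'⟩)
  rw [Setup.truncatedImage] at hmin
  rw [hmin, dist_eq_norm, dist_eq_norm, norm_sub_rev] at h1
  simpa using h1

lemma Setup.exists_isSol [FiniteDimensional ℝ E] (v : E) : ∃ s, S.IsSol v s := by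
  obtain ⟨x, z, hxz⟩ := S.exists_isPrimalOptimal v
  obtain ⟨w, hw, l, hl, h⟩ := S.exists_multipliers v hxz
  exact ⟨⟨x, z, w, l⟩, hxz, ⟨hw, hl⟩, fun w' hw' l' hl' =>
    (P.dualObjective_le hw' hl' hxz.1).trans (P.le_dualObjective_iff.2 h)⟩

/-- Optimal dual solutions are Lagrange multipliers. -/
lemma Setup.IsSol.le_lagrangian {S : Setup P} {v : E} {s : Sol n E} (hs : S.IsSol v s) :
    ∀ x ∈ P.feas, ∀ z : E,
      ‖s.z‖ ≤ ‖z‖ + s.w (P.Γ x - z - v) + s.l * (S.wbar (v + z) - S.γ) := by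
  obtain ⟨w, hw, l, hl, h⟩ := S.exists_multipliers v hs.1
  -- The multipliers already reach the dual value ‖z‖, so an arbitrary dual optimum does too.
  exact P.le_dualObjective_iff.1 ((P.le_dualObjective_iff.2 h).trans (hs.2.2 w hw l hl))

/-! ### Geometry of the cuts -/

/-- The normal `w̃ = w - l w̄` of the cut defined by a solution record. -/
noncomputable def Setup.cutNormal (s : Sol n E) : StrongDual ℝ E := s.w - s.l • S.wbar

variable {S}

/-- Otherwise the Lagrangian would be unbounded below along a ray in z. -/
lemma Setup.IsSol.norm_cutNormal_le {v : E} {s : Sol n E} (hs : S.IsSol v s) :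
    ‖S.cutNormal s‖ ≤ 1 := by
  obtain ⟨x, hx⟩ := P.feas_nonempty
  have key : ∀ z, S.cutNormal s z ≤ ‖z‖ := by
    intro z
    by_contra! hz
    let A := s.w (P.Γ x - v) + s.l * (S.wbar v - S.γ)
    let q := S.cutNormal s z - ‖z‖
    have hq : 0 < q := sub_pos.2 hz
    -- At this multiple of z the Lagrangian equals A - (|A| + 1) < 0, below ‖s.z‖.
    have ht : 0 ≤ (|A| + 1) / q := div_nonneg (by positivity) hq.le
    have h := hs.le_lagrangian x hx (((|A| + 1) / q) • z)
    have h1 : ‖((|A| + 1) / q) • z‖ = (|A| + 1) / q * ‖z‖ := by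
      rw [norm_smul, Real.norm_of_nonneg ht]
    have h2 : (|A| + 1) / q * q = |A| + 1 := div_mul_cancel₀ _ hq.ne'
    rw [h1] at h
    simp only [map_sub, map_add, map_smul, smul_eq_mul] at h
    simp only [q, A, Setup.cutNormal, sub_apply, smul_apply, smul_eq_mul, map_sub] at h h2
    have h3 := le_abs_self (s.w (P.Γ x) - s.w v + s.l * (S.wbar v - S.γ))
    have h4 := norm_nonneg s.z
    linarith
  refine ContinuousLinearMap.opNorm_le_bound _ zero_le_one fun z => ?_
  rw [one_mul, Real.norm_eq_abs, abs_le]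
  have := key (-z)
  rw [map_neg, norm_neg] at this
  exact ⟨by linarith, key z⟩

/-- Put z = 0 in the Lagrangian bound; the cone part of y and its slack in w̄ᵀy ≤ γ only help. -/
lemma Setup.IsSol.le_cutNormal {v : E} {s : Sol n E} (hs : S.IsSol v s) {y : E}
    (hy : y ∈ S.truncatedImage) : ‖s.z‖ ≤ S.cutNormal s (y - v) := by
  obtain ⟨⟨_, ⟨x, hx, rfl⟩, c, hc, rfl⟩, hγ⟩ := hy
  have h := hs.le_lagrangian x hx 0
  have h1 := hs.2.1.1 c hc
  have h2 := mul_nonneg hs.2.1.2 (sub_nonneg.2 hγ)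
  simp only [Setup.cutNormal, sub_apply, smul_apply, smul_eq_mul, map_sub, map_add, norm_zero,
    sub_zero, add_zero] at *
  linarith

/-- The dual norm bound gives ≤; the converse holds because v + z lies in the truncated image. -/
lemma Setup.IsSol.cutNormal_apply {v : E} {s : Sol n E} (hs : S.IsSol v s) :
    S.cutNormal s s.z = ‖s.z‖ := by
  refine le_antisymm ((le_abs_self _).trans ?_) ?_
  · simpa using (S.cutNormal s).le_of_opNorm_le hs.norm_cutNormal_le s.z
  · have := hs.le_cutNormal (P.exists_primalFeasible_iff.1 ⟨s.x, hs.1.1⟩)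
    rwa [add_sub_cancel_left] at this

/-- A cut keeps the truncated upper image. -/
lemma Setup.IsSol.cut_le {v : E} {s : Sol n E} (hs : S.IsSol v s) {y : E}
    (hy : y ∈ S.truncatedImage) : S.cutNormal s (v + s.z) ≤ S.cutNormal s y := by
  have h := hs.le_cutNormal hy
  rw [map_sub] at h
  rw [map_add, hs.cutNormal_apply]
  linarith

/-- A cut removes all points at distance less than `‖z‖` from `v`. -/
lemma Setup.IsSol.norm_le_dist {v : E} {s : Sol n E} (hs : S.IsSol v s) {y : E}
    (hy : S.cutNormal s (v + s.z) ≤ S.cutNormal s y) : ‖s.z‖ ≤ dist y v := by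
  rw [map_add, hs.cutNormal_apply] at hy
  have h := (S.cutNormal s).le_of_opNorm_le hs.norm_cutNormal_le (y - v)
  rw [map_sub, one_mul, ← dist_eq_norm y v, Real.norm_eq_abs] at h
  have := le_abs_self (S.cutNormal s y - S.cutNormal s v)
  linarith

/-! ### Executions -/

/-- Invariant of the program variables. -/
structure Setup.Valid (S : Setup P) (σ : State n E) : Prop where
  polyhedral : IsPolyhedralSet σ.outer
  subset_outer0 : σ.outer ⊆ S.outer0
  truncatedImage_subset : S.truncatedImage ⊆ σ.outer
  isSol : ∀ v ∈ σ.known ∪ σ.known2, S.IsSol v (σ.sol v)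

/-- Invariant of the configurations. -/
def Setup.Inv (S : Setup P) : Config n E → Prop
  | .start σ => S.Valid σ
  | .vertices todo σ => S.Valid σ ∧
      ∀ v ∈ σ.outer.extremePoints ℝ, v ∈ todo ∨ v ∈ σ.known ∪ σ.known2
  | .done _ => True

lemma Setup.valid_of_isInitialState {σ : State n E} (hσ : S.IsInitialState σ) : S.Valid σ := by
  obtain ⟨-, h1, -, h2, h3⟩ := hσ
  exact ⟨h1 ▸ S.isPolyhedralSet_outer0, h1.subset, h1 ▸ S.truncatedImage_subset_outer0, by
    simp [h2, h3]⟩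

lemma classify_outer (ε : ℝ) (v : E) (σ : State n E) : (σ.classify ε v).outer = σ.outer := by
  unfold State.classify; split_ifs <;> rfl

lemma classify_sol (ε : ℝ) (v : E) (σ : State n E) : (σ.classify ε v).sol = σ.sol := by
  unfold State.classify; split_ifs <;> rfl

lemma mem_classify_iff (ε : ℝ) (v u : E) (σ : State n E) :
    u ∈ (σ.classify ε v).known ∪ (σ.classify ε v).known2 ↔
      u = v ∨ u ∈ σ.known ∪ σ.known2 := by
  unfold State.classify; split_ifs <;> simp only [mem_union, mem_singleton_iff] <;> tauto

lemma Setup.Solve.spec {v : E} {σ τ : State n E} (h : S.Solve v σ τ) (hσ : S.Valid σ) :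
    τ.outer = σ.outer ∧ τ.known = σ.known ∧ τ.known2 = σ.known2 ∧
      ∀ u, u = v ∨ u ∈ σ.known ∪ σ.known2 → S.IsSol u (τ.sol u) := by
  rcases h with ⟨hv, rfl⟩ | ⟨-, s, hs, rfl⟩
  · refine ⟨rfl, rfl, rfl, ?_⟩
    rintro u (rfl | hu)
    exacts [hσ.isSol _ (Or.inr hv), hσ.isSol _ hu]
  · refine ⟨rfl, rfl, rfl, fun u hu => ?_⟩
    by_cases huv : u = v
    · subst huv
      simpa using hs
    · simpa [huv] using hσ.isSol u (hu.resolve_left huv)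

lemma Setup.Valid.cut {v : E} {σ : State n E} (hσ : S.Valid σ) (hv : S.IsSol v (σ.sol v)) :
    S.Valid (S.cut v σ) where
  polyhedral := hσ.polyhedral.inter_halfspace _ _
  subset_outer0 := inter_subset_left.trans hσ.subset_outer0
  truncatedImage_subset := fun _ hy => ⟨hσ.truncatedImage_subset hy, hv.cut_le hy⟩
  isSol := hσ.isSol

/-- Once the list is empty, every vertex has a stored optimal record, so each cut comes from a
genuine solution. -/
lemma Setup.Inv.step {ε : ℝ} {c c' : Config n E} (hc : S.Inv c) (h : Step S ε c c') :
    S.Inv c' := by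
  cases h with
  | enumerate σ todo _ hmem =>
    refine ⟨hc, fun v hv => ?_⟩
    by_cases hk : v ∈ σ.known
    exacts [Or.inr (Or.inl hk), Or.inl ((hmem v).2 ⟨hv, hk⟩)]
  | treat v todo σ τ hsolve =>
    obtain ⟨h1, h2, h3, h4⟩ := hsolve.spec hc.1
    refine ⟨⟨?_, ?_, ?_, ?_⟩, ?_⟩
    · rw [classify_outer, h1]; exact hc.1.polyhedral
    · rw [classify_outer, h1]; exact hc.1.subset_outer0
    · rw [classify_outer, h1]; exact hc.1.truncatedImage_subset
    · intro u hu
      rw [mem_classify_iff, h2, h3] at hu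
      rw [classify_sol]
      exact h4 u hu
    · intro u hu
      rw [classify_outer, h1] at hu
      rw [mem_classify_iff, h2, h3]
      rcases hc.2 u hu with hu | hu
      · rcases List.mem_cons.1 hu with hu | hu
        exacts [Or.inr (Or.inl hu), Or.inl hu]
      · exact Or.inr (Or.inr hu)
  | refine v σ hv hε =>
    exact hc.1.cut (hc.1.isSol v ((hc.2 v hv.1).resolve_left (by simp)))
  | stop_ v σ hv hε => trivial

/-- No execution gets stuck. -/
lemma Setup.Inv.exists_step [FiniteDimensional ℝ E] (hC : IsPolyhedralCone (P.C : Set E))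
    (ε : ℝ) {c : Config n E} (hc : S.Inv c) :
    (∃ τ, c = .done τ) ∨ ∃ c', Step S ε c c' := by
  match c, hc with
  | .done τ, _ => exact Or.inl ⟨τ, rfl⟩
  | .start σ, hσ =>
    have hfin : (σ.outer.extremePoints ℝ \ σ.known).Finite :=
      hσ.polyhedral.finite_extremePoints.subset sdiff_subset
    exact Or.inr ⟨_, .enumerate σ hfin.toFinset.toList (Finset.nodup_toList _) (by simp)⟩
  | .vertices [] σ, hσ =>
    have hcomp : IsCompact σ.outer := (S.isCompact_outer0 hC).of_isClosed_subset
      hσ.1.polyhedral.isClosed hσ.1.subset_outer0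
    have hne := hcomp.extremePoints_nonempty
      (S.truncatedImage_nonempty.mono hσ.1.truncatedImage_subset)
    obtain ⟨v, hv, hmax⟩ := Set.exists_max_image _ (fun u => ‖(σ.sol u).z‖)
      hσ.1.polyhedral.finite_extremePoints hne
    rcases lt_or_ge ε ‖(σ.sol v).z‖ with h | h
    exacts [Or.inr ⟨_, .refine v σ ⟨hv, hmax⟩ h⟩, Or.inr ⟨_, .stop_ v σ ⟨hv, hmax⟩ h⟩]
  | .vertices (v :: todo) σ, _ =>
    by_cases hv : v ∈ σ.known2
    · exact Or.inr ⟨_, .treat v todo σ σ (Or.inl ⟨hv, rfl⟩)⟩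
    · obtain ⟨s, hs⟩ := S.exists_isSol v
      exact Or.inr ⟨_, .treat v todo σ _ (Or.inr ⟨hv, s, hs, rfl⟩)⟩

/-! ### Termination measure -/

/-- The number of balls of radius `r` around points of `t` that meet `O`. -/
noncomputable def ballCount {α : Type*} [PseudoMetricSpace α] (t : Set α) (r : ℝ) (O : Set α) : ℕ :=
  {c ∈ t | (Metric.ball c r ∩ O).Nonempty}.ncard

/-- The termination measure. -/
noncomputable def Config.rank (t : Set E) (r : ℝ) : Config n E → ℕ ×ₗ ℕ
  -- A cut lowers the count b to some b' < b, so 2b' + 1 < 2b; enumeration then drops the extra 1.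
  -- The `+ 1` on the length keeps `done` strictly lowest even when b = 0.
  | .start σ => toLex (2 * ballCount t r σ.outer + 1, 0)
  | .vertices todo σ => toLex (2 * ballCount t r σ.outer, todo.length + 1)
  | .done _ => toLex (0, 0)

/-- A covering ball containing v has diameter at most ε, so it meets O but not O'. -/
lemma ballCount_lt {α : Type*} [PseudoMetricSpace α] {t : Set α} (ht : t.Finite) {ε : ℝ}
    {O O' : Set α} (hO : O' ⊆ O) {v : α} (hv : v ∈ O) (hvt : v ∈ ⋃ c ∈ t, Metric.ball c (ε / 2)) (hfar : ∀ y ∈ O', ε < dist y v) :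
    ballCount t (ε / 2) O' < ballCount t (ε / 2) O := by
  obtain ⟨c, hc, hvc⟩ := mem_iUnion₂.1 hvt
  refine Set.ncard_lt_ncard ?_ (ht.subset (sep_subset _ _))
  refine ssubset_iff_exists.2 ⟨fun d hd => ⟨hd.1, hd.2.mono (inter_subset_inter_right _ hO)⟩,
    c, ⟨hc, v, hvc, hv⟩, ?_⟩
  rintro ⟨-, y, hyc, hy⟩
  have h1 := hfar y hy
  have h2 := dist_triangle_right y v c
  rw [Metric.mem_ball] at hyc hvc
  linarith

lemma Setup.Inv.rank_lt {ε : ℝ} {t : Set E} (ht : t.Finite)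
    (hcover : S.outer0 ⊆ ⋃ c ∈ t, Metric.ball c (ε / 2)) {c c' : Config n E}
    (hc : S.Inv c) (h : Step S ε c c') : c'.rank t (ε / 2) < c.rank t (ε / 2) := by
  cases h with
  | enumerate σ todo _ hmem => exact Prod.Lex.toLex_lt_toLex.2 (Or.inl (Nat.lt_succ_self _))
  | treat v todo σ τ hsolve =>
    refine Prod.Lex.toLex_lt_toLex.2 (Or.inr ⟨?_, ?_⟩)
    · simp [classify_outer, (hsolve.spec hc.1).1]
    · simp
  | refine v σ hv hε =>
    have hs := hc.1.isSol v ((hc.2 v hv.1).resolve_left (by simp))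
    have := ballCount_lt ht (O := σ.outer) (O' := (S.cut v σ).outer) inter_subset_left hv.1.1
      (hcover (hc.1.subset_outer0 hv.1.1)) fun y hy => hε.trans_le (hs.norm_le_dist hy.2)
    exact Prod.Lex.toLex_lt_toLex.2 (Or.inl (by simp only; omega))
  | stop_ v σ hv hε =>
    refine Prod.Lex.toLex_lt_toLex.2 ?_
    rcases Nat.eq_zero_or_pos (2 * ballCount t (ε / 2) σ.outer) with h0 | h0
    exacts [Or.inr ⟨h0.symm, by simp⟩, Or.inl h0]

lemma Setup.terminates [FiniteDimensional ℝ E] (hC : IsPolyhedralCone (P.C : Set E))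
    (S : Setup P) {ε : ℝ} (hε : 0 < ε) : S.Terminates ε := by
  constructor
  · rintro ⟨c, ⟨σ, hσ, h0⟩, hstep⟩
    obtain ⟨t, -, ht, hcover⟩ := (S.isCompact_outer0 hC).finite_cover_balls (half_pos hε)
    have hinv : ∀ i, S.Inv (c i) := by
      intro i
      induction i with
      | zero => rw [h0]; exact S.valid_of_isInitialState hσ
      | succ i ih => exact ih.step (hstep i)
    exact not_strictAnti_of_wellFoundedLT (fun i => (c i).rank t (ε / 2))
      (strictAnti_nat_of_succ_lt fun i => (hinv i).rank_lt ht hcover (hstep i))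
  · intro σ c hσ hreach
    have hinv : S.Inv c := by
      induction hreach with
      | refl => exact S.valid_of_isInitialState hσ
      | tail _ h ih => exact ih.step h
    exact hinv.exists_step hC ε

end CVOPAlg

theorem mainTheorem3 {n : ℕ} {E : Type*} [NormedAddCommGroup E] [NormedSpace ℝ E]
    [FiniteDimensional ℝ E] (P : CVOPAlg.CVOP n E)
    (hC : CVOPAlg.IsPolyhedralCone (P.C : Set E)) :
    Nonempty (CVOPAlg.Setup P) ∧
      ∀ (S : CVOPAlg.Setup P) (ε : ℝ), 0 < ε → S.Terminates ε :=
  ⟨P.nonempty_setup hC, fun S _ hε => S.terminates hC hε⟩
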